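/- **Setting.** Let $T$ be a finite tournament with weights $w\colon V(T)\to\mathbb{R}_{\ge 0}$, and write $w(X)=\sum_{v\in X}w(v)$. A *feedback vertex set* (FVS) of $T$ is a set $X\subseteq V(T)$ such that $T-X$ is acyclic, and $\triangle(T)$ is the set of all $\{a,b,c\}\subseteq V(T)$ that induce a directed triangle. A pair $ab$ of distinct vertices is a *diagonal* if there are $u,v$ with $\{u,v,a\},\{u,v,b\}\in\triangle(T)$. $T$ is *light* if no triangle contains two diagonals. $\mathcal T_5$ is the set of tournaments on $5$ vertices whose smallest FVS has size $2$. $SA_0(T)$ is the set of $x\in[0,1]^{V(T)}$ with $x_a+x_b+x_c\ge1$ for all $\{a,b,c\}\in\triangle(T)$, and $SA_0(T,w)$ is the minimum of $\sum_v w(v)x_v$ over $SA_0(T)$. $SA_1(T)$ is the set of $x\in[0,1]^{V(T)}$ for which there are numbers $x_{ab}$ (indexed by unordered pairs) with $x_a\ge x_{ab}\ge0$ for all distinct $a,b$, and, for all $\{a,b,c\}\in\triangle(T)$ (in every labelling) and $d\in V(T)\setminus\{a,b,c\}$, $x_a+x_b+x_c\ge1+x_{ab}+x_{bc}$, $x_{ad}+x_{bd}+x_{cd}\ge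 x_d$ and $x_a+x_b+x_c+x_d\ge1+x_{ad}+x_{bd}+x_{cd}$. **Rounding phase.** Take an optimal solution $x$ of $\min\{\sum_v w(v)x_v : x\in SA_1(T)\}$ and put $F=\{v: x_v\ge 3/7\}$. If $F$ is an FVS of $T$, return it. Otherwise put $Z=\varnothing$ and iterate: add to $Z$ all vertices of $T-F-Z$ that lie in no triangle of $T-F-Z$; take an optimal solution $x$ of the linear program $SA_0(T-F-Z,w)$; add to $F$ all vertices $v$ of $T-F-Z$ with $x_v\ge1/2$. Stop after an iteration in which no $x_v$ was at least $1/2$, or when $T-F-Z$ is empty. Let $T'=T-F-Z$ for the final $F$ and $Z$. **Layering algorithm on $T'$.** Let $N(S)$ be the set of vertices of $T'$ outside $S$ with an arc into $S$, and $N(z)=N(\{z\})$. Start with $i=0$, $U_0=\varnothing$ and $W=V(T')$; sets $U_j,S_j,F_j$ that are never assigned are empty. While $W\ne\varnothing$: * If $N(U_i)\cap W\neq\varnothing$, choose $z,z'\in U_i$ (possibly equal) such that every vertex of $N(U_i)\cap W$ has an arc to $z$ or to $z'$, and $w(N(z)\cap W)\ge w(N(z')\cap W)$. Put $U_{i+1}=N(z)\cap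 W$ and $S_{i+1}=F_{i+1}=(N(z')\cap W)\setminus U_{i+1}$, remove $U_{i+1}\cup S_{i+1}$ from $W$, and increase $i$ by $1$. * Otherwise choose $z\in W$ with $|N(z)\cap W|$ minimum. Put $U_{i+1}=\{z\}$, $S_{i+1}=F_{i+1}=\varnothing$, $U_{i+2}=N(z)\cap W$, $S_{i+2}=\varnothing$, and let $F_{i+2}$ be the answer, on $T'[U_{i+2}]$, of a subroutine that returns a minimum-weight FVS of every $\mathcal T_5$-free input (nothing is assumed about its answer on other inputs). Remove $U_{i+1}\cup U_{i+2}$ from $W$, and increase $i$ by $2$. When $W=\varnothing$, let $L_0$ and $L_1$ be the unions of $U_j\cup S_j$ over even and over odd $j$. Output $F'=L_1\cup\bigcup_{j\text{ even}}F_j$ if $w(L_0)\ge w(L_1)$, and $F'=L_0\cup\bigcup_{j\text{ odd}}F_j$ otherwise. **Lemma.** For all choices made in the rounding phase: 1. $T'$ is light and every vertex of $T'$ lies in a triangle of $T'$. 2. Whatever choices are made, the layering algorithm on $T'$ never gets stuck (the required $z,z'$ exist) and takes at most $|V(T')|$ passes through the loop. In particular it has an output. 3. Every possible output $F'$ satisfies: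 $F\cup F'$ is a feedback vertex set of $T$, and $$w(F')\le\tfrac34\,w(V(T'))=\tfrac94\,SA_0(T',w).$$ Moreover $w(F')\le\tfrac94\,w(X)$ for every feedback vertex set $X$ of $T'$, so the layering step has approximation ratio $9/4$ on $T'$. -/

import Mathlib

open Finset

/-- A finite tournament whose vertices are elements of an ambient type `V`:
a finite vertex set `verts` and an arc relation between vertices such that every two distinct
vertices are joined by exactly one arc (and there are no loops, by `asymm`). -/
structure Tournament (V : Type*) where
  verts : Finset V
  Adj : V → V → Prop
  adj_left : ∀ {a b}, Adj a b → a ∈ verts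
  adj_right : ∀ {a b}, Adj a b → b ∈ verts
  asymm : ∀ {a b}, Adj a b → ¬ Adj b a
  total : ∀ {a b}, a ∈ verts → b ∈ verts → a ≠ b → Adj a b ∨ Adj b a

/-- The total weight `w(X)` of a finite set of vertices. -/
def weight {V : Type*} (w : V → ℝ) (X : Finset V) : ℝ := ∑ v ∈ X, w v

namespace Tournament

section Basic

variable {V : Type*} [DecidableEq V]

/-- The subtournament `T[X]` induced by the vertices of `T` lying in `X`. -/
def induce (T : Tournament V) (X : Finset V) : Tournament V where
  verts := T.verts ∩ X
  Adj a b := T.Adj a b ∧ a ∈ X ∧ b ∈ X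
  adj_left h := mem_inter.2 ⟨T.adj_left h.1, h.2.1⟩
  adj_right h := mem_inter.2 ⟨T.adj_right h.1, h.2.2⟩
  asymm h h' := T.asymm h.1 h'.1
  total ha hb hne :=
    (T.total (mem_inter.1 ha).1 (mem_inter.1 hb).1 hne).imp
      (fun h => ⟨h, (mem_inter.1 ha).2, (mem_inter.1 hb).2⟩)
      (fun h => ⟨h, (mem_inter.1 hb).2, (mem_inter.1 ha).2⟩)

/-- The tournament `T - X` obtained by deleting the vertices in `X`. -/
def delete (T : Tournament V) (X : Finset V) : Tournament V := T.induce (T.verts \ X)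

/-- There is no directed cycle. -/
def Acyclic (T : Tournament V) : Prop := ∀ v, ¬ Relation.TransGen T.Adj v v

/-- `X` is a feedback vertex set of `T`. -/
def IsFVS (T : Tournament V) (X : Finset V) : Prop := X ⊆ T.verts ∧ (T.delete X).Acyclic

/-- `X` is a feedback vertex set of `T` of minimum weight. -/
def IsMinFVS (T : Tournament V) (w : V → ℝ) (X : Finset V) : Prop :=
  T.IsFVS X ∧ ∀ Y, T.IsFVS Y → weight w X ≤ weight w Y

/-- The collection of (vertex sets of) directed triangles of `T`. -/
def triangles (T : Tournament V) : Set (Finset V) :=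
  {t | ∃ a b c, t = {a, b, c} ∧ T.Adj a b ∧ T.Adj b c ∧ T.Adj c a}

/-- The unordered pair of distinct vertices `a`, `b` is a diagonal. -/
def IsDiagonal (T : Tournament V) (a b : V) : Prop :=
  a ≠ b ∧ ∃ u v, {u, v, a} ∈ T.triangles ∧ {u, v, b} ∈ T.triangles

/-- A triangle is heavy if it contains at least two diagonals; two different pairs of vertices of
a triangle always share exactly one vertex, called `b` here. -/
def IsHeavyTriangle (T : Tournament V) (t : Finset V) : Prop :=
  t ∈ T.triangles ∧ ∃ a b c, t = {a, b, c} ∧ T.IsDiagonal a b ∧ T.IsDiagonal b c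

/-- A tournament is light if it has no heavy triangle. -/
def Light (T : Tournament V) : Prop := ∀ t, ¬ T.IsHeavyTriangle t

/-- `T` is (isomorphic to) a member of `𝒯₅`: it has five vertices and the minimum size of a
feedback vertex set is two. -/
def InT5 (T : Tournament V) : Prop :=
  T.verts.card = 5 ∧ IsLeast {n | ∃ X, T.IsFVS X ∧ X.card = n} 2

/-- No subtournament of `T` is isomorphic to a member of `𝒯₅`. -/
def T5Free (T : Tournament V) : Prop := ∀ X, X ⊆ T.verts → ¬ (T.induce X).InT5

/-! ### The linear relaxations. Points are functions on `V`, of which only the coordinates in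
`T.verts` matter. -/

/-- The basic relaxation `P(T) = SA₀(T)`. -/
def SA0Polytope (T : Tournament V) : Set (V → ℝ) :=
  {x | (∀ v ∈ T.verts, 0 ≤ x v ∧ x v ≤ 1) ∧
    ∀ a b c, {a, b, c} ∈ T.triangles → 1 ≤ x a + x b + x c}

/-- The polytope `SA₁(T)` given by one round of the Sherali-Adams hierarchy; `y s(a, b)` is the
variable belonging to the unordered pair `ab`. -/
def SA1Polytope (T : Tournament V) : Set (V → ℝ) :=
  {x | (∀ v ∈ T.verts, 0 ≤ x v ∧ x v ≤ 1) ∧ ∃ y : Sym2 V → ℝ,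
    (∀ a ∈ T.verts, ∀ b ∈ T.verts, a ≠ b → 0 ≤ y s(a, b) ∧ y s(a, b) ≤ x a) ∧
    ∀ a b c, {a, b, c} ∈ T.triangles →
      1 + y s(a, b) + y s(b, c) ≤ x a + x b + x c ∧
      ∀ d ∈ T.verts, d ≠ a → d ≠ b → d ≠ c →
        x d ≤ y s(a, d) + y s(b, d) + y s(c, d) ∧
        1 + y s(a, d) + y s(b, d) + y s(c, d) ≤ x a + x b + x c + x d}

/-- The objective function `∑_{v ∈ V(T)} w(v) x_v`. -/
def objective (T : Tournament V) (w x : V → ℝ) : ℝ := ∑ v ∈ T.verts, w v * x v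

/-- `x` minimizes the objective function over `P`. -/
def IsOptimal (T : Tournament V) (w : V → ℝ) (P : Set (V → ℝ)) (x : V → ℝ) : Prop :=
  x ∈ P ∧ ∀ y ∈ P, T.objective w x ≤ T.objective w y

/-- The value `SA₀(T, w)` of the basic relaxation (the infimum is over a nonempty set that is
bounded below if `w ≥ 0`). -/
noncomputable def SA0 (T : Tournament V) (w : V → ℝ) : ℝ :=
  sInf (T.objective w '' T.SA0Polytope)

end Basic

/-! ### The rounding phase -/

section Rounding

variable {V : Type*} [DecidableEq V]

open Classical in
/-- The vertices that are contained in no triangle. -/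
noncomputable def triangleFreeVerts (T : Tournament V) : Finset V :=
  T.verts.filter fun v => ∀ t ∈ T.triangles, v ∉ t

open Classical in
/-- The vertices `v` with `x_v ≥ c`. -/
noncomputable def vertsAbove (T : Tournament V) (x : V → ℝ) (c : ℝ) : Finset V :=
  T.verts.filter fun v => c ≤ x v

/-- One iteration of the rounding loop turns `(F, Z)` into `(F', Z')`: the vertices of
`T - F - Z` in no triangle are added to `Z`, then `x` is an optimal solution of the basic
relaxation of the remaining tournament and the vertices with `x_v ≥ 1/2` are added to `F`. -/
structure RoundingIteration (T : Tournament V) (w : V → ℝ) (F Z : Finset V) (x : V → ℝ)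
    (F' Z' : Finset V) : Prop where
  Z_eq : Z' = Z ∪ (T.delete (F ∪ Z)).triangleFreeVerts
  optimal : (T.delete (F ∪ Z')).IsOptimal w (T.delete (F ∪ Z')).SA0Polytope x
  F_eq : F' = F ∪ (T.delete (F ∪ Z')).vertsAbove x (1 / 2)

/-- The loop is left after an iteration that makes the remaining tournament empty or in which
all coordinates of the optimal solution `x` are smaller than `1/2`. -/
def RoundingStop (T : Tournament V) (F Z' : Finset V) (x : V → ℝ) (F' : Finset V) : Prop :=
  (T.delete (F' ∪ Z')).verts = ∅ ∨ ∀ v ∈ (T.delete (F ∪ Z')).verts, x v < 1 / 2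

/-- `(F, Z)` are possible values of the two sets at the beginning of an iteration of the loop. -/
inductive RoundingState (T : Tournament V) (w : V → ℝ) : Finset V → Finset V → Prop
  | init (x : V → ℝ) (hx : T.IsOptimal w T.SA1Polytope x)
      (hF : ¬ T.IsFVS (T.vertsAbove x (3 / 7))) :
      RoundingState T w (T.vertsAbove x (3 / 7)) ∅
  | next (F Z : Finset V) (x : V → ℝ) (F' Z' : Finset V) (h : RoundingState T w F Z)
      (hit : T.RoundingIteration w F Z x F' Z') (hgo : ¬ T.RoundingStop F Z' x F') :
      RoundingState T w F' Z'

/-- `(F', Z')` are possible values of the two sets when the rounding phase ends. -/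
def RoundingOutput (T : Tournament V) (w : V → ℝ) (F' Z' : Finset V) : Prop :=
  ∃ F Z x, T.RoundingState w F Z ∧ T.RoundingIteration w F Z x F' Z' ∧ T.RoundingStop F Z' x F'

end Rounding

/-! ### The layering algorithm -/

section Layers

variable {V : Type*} [DecidableEq V]

open Classical in
/-- The in-neighborhood `N(S)` of a set of vertices. -/
noncomputable def inNbhd (T : Tournament V) (S : Finset V) : Finset V :=
  T.verts.filter fun v => v ∉ S ∧ ∃ u ∈ S, T.Adj v u

/-- `Z` in-dominates `S`. -/
def InDominates (T : Tournament V) (Z S : Finset V) : Prop := ∀ s ∈ S, ∃ z ∈ Z, T.Adj s z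

/-- `C` is a possible answer of the exact algorithm for `𝒯₅`-free tournaments on input `T`:
if `T` is `𝒯₅`-free, then it is a minimum weight feedback vertex set. Nothing is known about the
answer on other inputs. -/
def CDZAnswer (T : Tournament V) (w : V → ℝ) (C : Finset V) : Prop :=
  T.T5Free → T.IsMinFVS w C

/-- The data of the layering algorithm: the index `i` of the current root layer, the sets
`U_j`, `S_j`, `F_j` (empty where not yet defined), and the set `W` of unseen vertices. -/
structure LayersState (V : Type*) where
  i : ℕ
  U : ℕ → Finset V
  S : ℕ → Finset V
  F : ℕ → Finset V
  W : Finset V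

/-- The data at the first call. -/
def layersInit (T : Tournament V) : LayersState V where
  i := 0
  U _ := ∅
  S _ := ∅
  F _ := ∅
  W := T.verts

/-- `T.LayersStep w s s'`: a call of the layering algorithm with data `s` and `s.W ≠ ∅` may lead to
a recursive call with data `s'`. -/
inductive LayersStep (T : Tournament V) (w : V → ℝ) : LayersState V → LayersState V → Prop
  | grow (s : LayersState V) (z z' : V) (hW : s.W.Nonempty)
      (hN : (T.inNbhd (s.U s.i) ∩ s.W).Nonempty)
      (hz : z ∈ s.U s.i) (hz' : z' ∈ s.U s.i)
      (hdom : T.InDominates {z, z'} (T.inNbhd (s.U s.i) ∩ s.W))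
      (hw : weight w (T.inNbhd {z'} ∩ s.W) ≤ weight w (T.inNbhd {z} ∩ s.W)) :
      LayersStep T w s
        { i := s.i + 1
          U := Function.update s.U (s.i + 1) (T.inNbhd {z} ∩ s.W)
          S := Function.update s.S (s.i + 1) ((T.inNbhd {z'} ∩ s.W) \ (T.inNbhd {z} ∩ s.W))
          F := Function.update s.F (s.i + 1) ((T.inNbhd {z'} ∩ s.W) \ (T.inNbhd {z} ∩ s.W))
          W := s.W \ ((T.inNbhd {z} ∩ s.W) ∪
            ((T.inNbhd {z'} ∩ s.W) \ (T.inNbhd {z} ∩ s.W))) }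
  | fresh (s : LayersState V) (z : V) (C : Finset V)
      (hN : T.inNbhd (s.U s.i) ∩ s.W = ∅)
      (hz : z ∈ s.W)
      (hmin : ∀ v ∈ s.W, (T.inNbhd {z} ∩ s.W).card ≤ (T.inNbhd {v} ∩ s.W).card)
      (hC : (T.induce (T.inNbhd {z} ∩ s.W)).CDZAnswer w C) :
      LayersStep T w s
        { i := s.i + 2
          U := Function.update (Function.update s.U (s.i + 1) {z})
            (s.i + 2) (T.inNbhd {z} ∩ s.W)
          S := Function.update (Function.update s.S (s.i + 1) ∅) (s.i + 2) ∅
          F := Function.update (Function.update s.F (s.i + 1) ∅) (s.i + 2) C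
          W := s.W \ ({z} ∪ (T.inNbhd {z} ∩ s.W)) }

/-- Some run of the layering algorithm on `(T, w)` has data `s` after `n` recursive calls. -/
inductive LayersReach (T : Tournament V) (w : V → ℝ) : ℕ → LayersState V → Prop
  | init : LayersReach T w 0 T.layersInit
  | step (n : ℕ) (s s' : LayersState V) (h : LayersReach T w n s) (hs : T.LayersStep w s s') :
      LayersReach T w (n + 1) s'

/-- The union of the layers `U_j ∪ S_j` with `j` even (`p = 0`) or odd (`p = 1`). -/
def LayersState.layers (s : LayersState V) (p : ℕ) : Finset V :=
  ((range (s.i + 1)).filter fun j => j % 2 = p).biUnion fun j => s.U j ∪ s.S j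

/-- The union of the local solutions `F_j` with `j` even (`p = 0`) or odd (`p = 1`). -/
def LayersState.localSolutions (s : LayersState V) (p : ℕ) : Finset V :=
  ((range (s.i + 1)).filter fun j => j % 2 = p).biUnion s.F

/-- The set returned in the last call. -/
noncomputable def LayersState.result (w : V → ℝ) (s : LayersState V) : Finset V :=
  if weight w (s.layers 1) ≤ weight w (s.layers 0) then s.localSolutions 0 ∪ s.layers 1
  else s.localSolutions 1 ∪ s.layers 0

/-- `F'` is a possible output of the layering algorithm on `(T, w)`. -/
def LayersOutput (T : Tournament V) (w : V → ℝ) (F' : Finset V) : Prop :=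
  ∃ n s, T.LayersReach w n s ∧ s.W = ∅ ∧ F' = s.result w

end Layers

end Tournament

/-! Lightness of the residual tournament `T'` comes from the `SA₁` inequalities. If uva and uvb are
triangles with x_u, x_v < 3/7, then x_ab ≥ 1 - x_u - x_v > 1/7. A triangle with two diagonals would
thus have coordinate sum above 9/7, although each coordinate is below 3/7. If `T'` is nonempty, the
last optimal solution of the basic relaxation has all coordinates strictly between 0 and 1/2. It can
then be pushed slightly away from the constant point 1/3, so this constant point is optimal too and
SA₀(T', w) = w(V(T'))/3 (`RoundingOutput.SA0_eq`). This turns the bound 3/4 · w(V(T')) into the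
ratio 9/4.

The layering works on a configuration U → y → R, with R the unseen vertices. The out-neighborhoods
in U of vertices of R contain no three pairwise incomparable sets (`Light.not_three_incomparable`):
three vertices span a directed path, and two incomparable pairs along it force a heavy triangle.
Hence two vertices of U in-dominate all in-neighbors of U in R, so the algorithm never gets stuck.
Also U contains no triangle if each of its vertices has an in-neighbor in R, which holds for the
in-neighborhood of a vertex of minimum in-degree. A grown layer U_{i+1} is triangle-free because its
vertices are apexes on one arc.

So each U_j is triangle-free and each F_j has at most half the weight of its layer. All arcs between
U_j and U_k go forward when j + 2 ≤ k, so a triangle among the U_j of one parity would lie in a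
single U_j. Paying fully for the lighter parity class and half for the heavier one costs at most 3/4
of the total. -/

namespace Tournament

/-! ### Triangles, feedback vertex sets and diagonals. -/

section Triangles

variable {V : Type*} {T : Tournament V}

lemma ne_of_adj {a b : V} (h : T.Adj a b) : a ≠ b := by
  rintro rfl
  exact T.asymm h h

lemma adj_of_not_adj {a b : V} (ha : a ∈ T.verts) (hb : b ∈ T.verts) (hne : a ≠ b)
    (h : ¬ T.Adj a b) : T.Adj b a :=
  (T.total ha hb hne).resolve_left h

/-- Without triangles the arc relation is transitive, so a directed cycle would collapse to a loop.
-/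
lemma acyclic_of_forall_not_triangle
    (h : ∀ a b c, T.Adj a b → T.Adj b c → ¬ T.Adj c a) : T.Acyclic := by
  have htrans : ∀ a b c, T.Adj a b → T.Adj b c → T.Adj a c := by
    intro a b c hab hbc
    refine adj_of_not_adj (T.adj_right hbc) (T.adj_left hab) ?_ (h a b c hab hbc)
    rintro rfl
    exact T.asymm hab hbc
  have key : ∀ a b, Relation.TransGen T.Adj a b → T.Adj a b := by
    intro a b hab
    induction hab with
    | single h => exact h
    | tail _ h ih => exact htrans _ _ _ ih h
  intro v hv
  exact ne_of_adj (key v v hv) rfl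

lemma Acyclic.not_triangle (h : T.Acyclic) {a b c : V} (hab : T.Adj a b) (hbc : T.Adj b c) :
    ¬ T.Adj c a := fun hca =>
  h a (((Relation.TransGen.single hab).tail hbc).tail hca)

variable [DecidableEq V]

lemma delete_adj {X : Finset V} {a b : V} :
    (T.delete X).Adj a b ↔ T.Adj a b ∧ a ∉ X ∧ b ∉ X := by
  simp only [delete, induce, mem_sdiff]
  exact ⟨fun h => ⟨h.1, h.2.1.2, h.2.2.2⟩,
    fun h => ⟨h.1, ⟨T.adj_left h.1, h.2.1⟩, ⟨T.adj_right h.1, h.2.2⟩⟩⟩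

lemma delete_verts (X : Finset V) : (T.delete X).verts = T.verts \ X := by
  simp [delete, induce]

lemma isFVS_iff {X : Finset V} :
    T.IsFVS X ↔ X ⊆ T.verts ∧ ∀ a b c, a ∉ X → b ∉ X → c ∉ X →
      T.Adj a b → T.Adj b c → ¬ T.Adj c a := by
  refine and_congr_right fun _ => ⟨fun h a b c ha hb hc hab hbc hca => ?_, fun h => ?_⟩
  · exact h.not_triangle (delete_adj.2 ⟨hab, ha, hb⟩) (delete_adj.2 ⟨hbc, hb, hc⟩)
      (delete_adj.2 ⟨hca, hc, ha⟩)
  · refine acyclic_of_forall_not_triangle fun a b c hab hbc hca => ?_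
    rw [delete_adj] at hab hbc hca
    exact h a b c hab.2.1 hbc.2.1 hca.2.1 hab.1 hbc.1 hca.1

lemma mem_triangles_of_adj {a b c : V} (hab : T.Adj a b) (hbc : T.Adj b c) (hca : T.Adj c a) :
    {a, b, c} ∈ T.triangles := ⟨a, b, c, rfl, hab, hbc, hca⟩

lemma card_of_mem_triangles {t : Finset V} (h : t ∈ T.triangles) : t.card = 3 := by
  obtain ⟨a, b, c, rfl, hab, hbc, hca⟩ := h
  exact card_eq_three.2 ⟨a, b, c, ne_of_adj hab, (ne_of_adj hca).symm, ne_of_adj hbc, rfl⟩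

lemma ne_of_mem_triangles {a b c : V} (h : {a, b, c} ∈ T.triangles) :
    a ≠ b ∧ b ≠ c ∧ a ≠ c := by
  have h3 := card_of_mem_triangles h
  refine ⟨?_, ?_, ?_⟩ <;> rintro rfl
  · have := card_le_two (a := a) (b := c)
    simp_all
  · have := card_le_two (a := a) (b := b)
    simp_all
  · have := card_le_two (a := a) (b := b)
    rw [insert_eq_of_mem (by simp), pair_comm] at h3
    omega

lemma triangle_subset_verts {t : Finset V} (h : t ∈ T.triangles) : t ⊆ T.verts := by
  obtain ⟨a, b, c, rfl, hab, hbc, hca⟩ := h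
  intro v hv
  simp only [mem_insert, mem_singleton] at hv
  rcases hv with rfl | rfl | rfl
  exacts [T.adj_left hab, T.adj_left hbc, T.adj_left hca]

lemma mem_triangles_delete {X t : Finset V} :
    t ∈ (T.delete X).triangles ↔ t ∈ T.triangles ∧ Disjoint t X := by
  constructor
  · rintro ⟨a, b, c, rfl, hab, hbc, hca⟩
    rw [delete_adj] at hab hbc hca
    refine ⟨mem_triangles_of_adj hab.1 hbc.1 hca.1, ?_⟩
    simp [disjoint_insert_left, hab.2.1, hbc.2.1, hca.2.1]
  · rintro ⟨⟨a, b, c, rfl, hab, hbc, hca⟩, hd⟩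
    simp only [disjoint_insert_left, disjoint_singleton_left] at hd
    obtain ⟨ha, hb, hc⟩ := hd
    exact mem_triangles_of_adj (delete_adj.2 ⟨hab, ha, hb⟩) (delete_adj.2 ⟨hbc, hb, hc⟩)
      (delete_adj.2 ⟨hca, hc, ha⟩)

lemma IsFVS.not_disjoint {X t : Finset V} (hX : T.IsFVS X) (ht : t ∈ T.triangles) :
    ¬ Disjoint t X := by
  obtain ⟨a, b, c, rfl, hab, hbc, hca⟩ := ht
  simp only [disjoint_insert_left, disjoint_singleton_left]
  rintro ⟨ha, hb, hc⟩
  exact (isFVS_iff.1 hX).2 a b c ha hb hc hab hbc hca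

lemma isFVS_of_not_disjoint {X : Finset V} (hX : X ⊆ T.verts)
    (h : ∀ t ∈ T.triangles, ¬ Disjoint t X) : T.IsFVS X := by
  refine isFVS_iff.2 ⟨hX, fun a b c ha hb hc hab hbc hca => ?_⟩
  exact h _ (mem_triangles_of_adj hab hbc hca) (by simp [disjoint_insert_left, ha, hb, hc])

/-- Two triangles on the same arc `u → v` make their apexes a diagonal. -/
lemma isDiagonal_of_adj {u v a b : V} (huv : T.Adj u v) (hva : T.Adj v a) (hau : T.Adj a u)
    (hvb : T.Adj v b) (hbu : T.Adj b u) (hne : a ≠ b) : T.IsDiagonal a b :=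
  ⟨hne, u, v, mem_triangles_of_adj huv hva hau, mem_triangles_of_adj huv hvb hbu⟩

lemma IsDiagonal.symm {a b : V} (h : T.IsDiagonal a b) : T.IsDiagonal b a := by
  obtain ⟨hne, u, v, h1, h2⟩ := h
  exact ⟨hne.symm, u, v, h2, h1⟩

lemma Light.not_two_diagonals (h : T.Light) {a b c : V} (hab : T.Adj a b) (hbc : T.Adj b c)
    (hca : T.Adj c a) (h1 : T.IsDiagonal a b) (h2 : T.IsDiagonal b c) : False :=
  h _ ⟨mem_triangles_of_adj hab hbc hca, a, b, c, rfl, h1, h2⟩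

end Triangles

/-! ### Incomparable out-neighborhoods in light tournaments. -/

section LightLayers

variable {V : Type*} {T : Tournament V}

open Classical in
/-- The out-neighbors of `v` in `U`. -/
noncomputable def outIn (T : Tournament V) (U : Finset V) (v : V) : Finset V :=
  U.filter fun u => T.Adj v u

lemma mem_outIn {U : Finset V} {u v : V} : u ∈ T.outIn U v ↔ u ∈ U ∧ T.Adj v u := by
  simp [outIn]

lemma exists_of_not_outIn_subset {U : Finset V} {y v v' : V} (hU : ∀ u ∈ U, T.Adj u y)
    (hv' : T.Adj y v') (h : ¬ T.outIn U v ⊆ T.outIn U v') :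
    ∃ u ∈ U, T.Adj v u ∧ T.Adj u v' := by
  obtain ⟨u, hu, hu'⟩ := not_subset.1 h
  rw [mem_outIn] at hu hu'
  refine ⟨u, hu.1, hu.2, adj_of_not_adj (T.adj_right hv') (T.adj_left (hU u hu.1)) ?_
    fun hcon => hu' ⟨hu.1, hcon⟩⟩
  rintro rfl
  exact T.asymm (hU _ hu.1) hv'

variable [DecidableEq V]

/-- The configuration forced by two vertices of a layer whose out-neighborhoods in the
preceding layer are incomparable. -/
lemma Light.adj_and_diagonals (h : T.Light) {y v₁ v₂ u₁ u₂ : V} (hv : T.Adj v₁ v₂)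
    (h11 : T.Adj v₁ u₁) (h12 : T.Adj u₁ v₂) (h22 : T.Adj v₂ u₂) (h21 : T.Adj u₂ v₁)
    (hu₁ : T.Adj u₁ y) (hu₂ : T.Adj u₂ y) (hv₁ : T.Adj y v₁) (hv₂ : T.Adj y v₂) :
    T.Adj u₁ u₂ ∧ T.IsDiagonal v₁ y ∧ T.IsDiagonal u₂ y ∧ T.IsDiagonal v₂ u₁ := by
  have hne : u₁ ≠ u₂ := by
    rintro rfl
    exact T.asymm h12 h22
  have hd : T.IsDiagonal v₁ y :=
    isDiagonal_of_adj h22 h21 hv hu₂ hv₂ (ne_of_adj hv₁).symm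
  have hu : T.Adj u₁ u₂ := by
    by_contra hcon
    have hu := adj_of_not_adj (T.adj_left hu₁) (T.adj_left hu₂) hne hcon
    -- If u₂ → u₁, then v₁, y and u₁ are all apexes on the arc v₂ → u₂, which makes the triangle y
    -- v₁ u₁ heavy.
    have hd' : T.IsDiagonal y u₁ :=
      isDiagonal_of_adj h22 hu₂ hv₂ hu h12 (ne_of_adj hu₁).symm
    exact h.not_two_diagonals hv₁ h11 hu₁ hd.symm
      (isDiagonal_of_adj h22 h21 hv hu h12 (ne_of_adj h11))
  refine ⟨hu, hd, ?_, ?_⟩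
  · exact isDiagonal_of_adj h11 hu h21 hu₁ hv₁ (ne_of_adj hu₂)
  · exact (isDiagonal_of_adj h21 h11 hu hv h22 (ne_of_adj h12)).symm

/-- If c → u₁, then c u₁ v₂ is a triangle. Its pair c u₁ is a diagonal through the arc y → v₁, and
u₁ v₂ is one by `Light.adj_and_diagonals`. -/
lemma Light.adj_common (h : T.Light) {y v₁ v₂ u₁ u₂ c : V} (hv : T.Adj v₁ v₂)
    (h11 : T.Adj v₁ u₁) (h12 : T.Adj u₁ v₂) (h22 : T.Adj v₂ u₂) (h21 : T.Adj u₂ v₁)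
    (hu₁ : T.Adj u₁ y) (hu₂ : T.Adj u₂ y) (hv₁ : T.Adj y v₁) (hv₂ : T.Adj y v₂)
    (hc : T.Adj c y) (h1c : T.Adj v₁ c) (h2c : T.Adj v₂ c) : T.Adj u₁ c := by
  have hne : u₁ ≠ c := by
    rintro rfl
    exact T.asymm h12 h2c
  by_contra hcon
  have hcu := adj_of_not_adj (T.adj_left hu₁) (T.adj_left hc) hne hcon
  obtain ⟨-, -, -, hd⟩ := h.adj_and_diagonals hv h11 h12 h22 h21 hu₁ hu₂ hv₁ hv₂
  exact h.not_two_diagonals hcu h12 h2c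
    (isDiagonal_of_adj hv₁ h1c hc h11 hu₁ hne.symm) hd.symm

/-- The pair v₁, v₂ yields some b in U with v₂ → b and b y a diagonal, while the pair v₂, v₃ makes
v₂ y a diagonal. Both lie in the triangle b y v₂. -/
lemma Light.not_incomparable_path (h : T.Light) {U : Finset V} {y v₁ v₂ v₃ : V}
    (hU : ∀ u ∈ U, T.Adj u y) (h1 : T.Adj y v₁) (h2 : T.Adj y v₂) (h3 : T.Adj y v₃)
    (h12 : T.Adj v₁ v₂) (h23 : T.Adj v₂ v₃)
    (hD12 : ¬ T.outIn U v₁ ⊆ T.outIn U v₂) (hD21 : ¬ T.outIn U v₂ ⊆ T.outIn U v₁)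
    (hD23 : ¬ T.outIn U v₂ ⊆ T.outIn U v₃) (hD32 : ¬ T.outIn U v₃ ⊆ T.outIn U v₂) : False := by
  obtain ⟨a, ha, ha1, ha2⟩ := exists_of_not_outIn_subset hU h2 hD12
  obtain ⟨b, hb, hb1, hb2⟩ := exists_of_not_outIn_subset hU h1 hD21
  obtain ⟨c, hc, hc1, hc2⟩ := exists_of_not_outIn_subset hU h3 hD23
  obtain ⟨d, hd, hd1, hd2⟩ := exists_of_not_outIn_subset hU h2 hD32
  obtain ⟨-, -, hby, -⟩ := h.adj_and_diagonals h12 ha1 ha2 hb1 hb2 (hU a ha) (hU b hb) h1 h2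
  obtain ⟨-, hvy, -, -⟩ := h.adj_and_diagonals h23 hc1 hc2 hd1 hd2 (hU c hc) (hU d hd) h2 h3
  exact h.not_two_diagonals (hU b hb) h2 hb1 hby hvy.symm

end LightLayers
-- Two dominating vertices, and triangle-free layers.
section LightLayers

variable {V : Type*} {T : Tournament V}

/-- `U` and `R` are separated by `y`: every vertex of `U` has an arc to `y`, and `y` has an arc
to every vertex of `R`. -/
def Separates (T : Tournament V) (y : V) (U R : Finset V) : Prop :=
  (∀ u ∈ U, T.Adj u y) ∧ ∀ v ∈ R, T.Adj y v

lemma Separates.adj_of_not_adj {y u v : V} {U R : Finset V} (h : T.Separates y U R)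
    (hu : u ∈ U) (hv : v ∈ R) (hvu : ¬ T.Adj v u) : T.Adj u v := by
  refine Tournament.adj_of_not_adj (T.adj_right (h.2 v hv)) (T.adj_left (h.1 u hu)) ?_ hvu
  rintro rfl
  exact T.asymm (h.1 v hu) (h.2 v hv)

variable [DecidableEq V]

/-- However the three vertices are oriented, they contain a directed path on three vertices, which
`Light.not_incomparable_path` excludes. -/
lemma Light.not_three_incomparable (h : T.Light) {y : V} {U R : Finset V}
    (hy : T.Separates y U R) {v₁ v₂ v₃ : V} (h1 : v₁ ∈ R) (h2 : v₂ ∈ R) (h3 : v₃ ∈ R)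
    (hD12 : ¬ T.outIn U v₁ ⊆ T.outIn U v₂) (hD21 : ¬ T.outIn U v₂ ⊆ T.outIn U v₁)
    (hD23 : ¬ T.outIn U v₂ ⊆ T.outIn U v₃) (hD32 : ¬ T.outIn U v₃ ⊆ T.outIn U v₂)
    (hD13 : ¬ T.outIn U v₁ ⊆ T.outIn U v₃) (hD31 : ¬ T.outIn U v₃ ⊆ T.outIn U v₁) : False := by
  obtain ⟨hU, hR⟩ := hy
  replace h1 := hR _ h1
  replace h2 := hR _ h2
  replace h3 := hR _ h3
  have n12 : v₁ ≠ v₂ := by rintro rfl; exact hD12 subset_rfl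
  have n23 : v₂ ≠ v₃ := by rintro rfl; exact hD23 subset_rfl
  have n13 : v₁ ≠ v₃ := by rintro rfl; exact hD13 subset_rfl
  have t12 := T.total (T.adj_right h1) (T.adj_right h2) n12
  have t23 := T.total (T.adj_right h2) (T.adj_right h3) n23
  have t13 := T.total (T.adj_right h1) (T.adj_right h3) n13
  rcases t12 with a | a <;> rcases t23 with b | b
  · exact h.not_incomparable_path hU h1 h2 h3 a b hD12 hD21 hD23 hD32
  · rcases t13 with c | c
    · exact h.not_incomparable_path hU h1 h3 h2 c b hD13 hD31 hD32 hD23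
    · exact h.not_incomparable_path hU h3 h1 h2 c a hD31 hD13 hD12 hD21
  · rcases t13 with c | c
    · exact h.not_incomparable_path hU h2 h1 h3 a c hD21 hD12 hD13 hD31
    · exact h.not_incomparable_path hU h2 h3 h1 b c hD23 hD32 hD31 hD13
  · exact h.not_incomparable_path hU h3 h2 h1 b a hD32 hD23 hD21 hD12

/-- In a light tournament two vertices of `U` in-dominate the in-neighbors of `U` in `R`. -/
lemma Light.exists_inDominates (h : T.Light) {y : V} {U R N : Finset V}
    (hy : T.Separates y U R) (hNR : N ⊆ R) (hN : N.Nonempty)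
    (hne : ∀ v ∈ N, ∃ u ∈ U, T.Adj v u) :
    ∃ z ∈ U, ∃ z' ∈ U, T.InDominates {z, z'} N := by
  classical
  set 𝒟 := N.image (T.outIn U) with h𝒟
  have hmem : ∀ v ∈ N, T.outIn U v ∈ 𝒟 := fun v hv => mem_image_of_mem _ hv
  -- Every out-neighborhood contains a minimal one, so it suffices to pick one element from each
  -- minimal out-neighborhood. Distinct minimal ones are incomparable, hence there are at most two.
  have hmin : ∀ v ∈ N, ∃ m ∈ N, T.outIn U m ⊆ T.outIn U v ∧ Minimal (· ∈ 𝒟) (T.outIn U m) := by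
    intro v hv
    obtain ⟨D, hD, hDm⟩ := 𝒟.exists_le_minimal (hmem v hv)
    obtain ⟨m, hm, rfl⟩ := mem_image.1 hDm.prop
    exact ⟨m, hm, hD, hDm⟩
  have hinc : ∀ m m', Minimal (· ∈ 𝒟) (T.outIn U m) → Minimal (· ∈ 𝒟) (T.outIn U m') →
      T.outIn U m ≠ T.outIn U m' → ¬ T.outIn U m ⊆ T.outIn U m' := fun m m' hm hm' hne hs =>
    hne (hm'.eq_of_le hm.prop hs)
  obtain ⟨v₀, hv₀⟩ := hN
  obtain ⟨m, hm, -, hmm⟩ := hmin v₀ hv₀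
  obtain ⟨z, hz, hmz⟩ := hne m hm
  by_cases hall : ∀ m' ∈ N, Minimal (· ∈ 𝒟) (T.outIn U m') → T.outIn U m = T.outIn U m'
  · refine ⟨z, hz, z, hz, fun v hv => ⟨z, by simp, ?_⟩⟩
    obtain ⟨k, hk, hkv, hkm⟩ := hmin v hv
    exact (mem_outIn.1 (hkv (hall k hk hkm ▸ mem_outIn.2 ⟨hz, hmz⟩))).2
  · push Not at hall
    obtain ⟨m', hm', hmm', hne'⟩ := hall
    obtain ⟨z', hz', hmz'⟩ := hne m' hm'
    refine ⟨z, hz, z', hz', fun v hv => ?_⟩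
    obtain ⟨k, hk, hkv, hkm⟩ := hmin v hv
    by_cases h1 : T.outIn U m = T.outIn U k
    · exact ⟨z, by simp, (mem_outIn.1 (hkv (h1 ▸ mem_outIn.2 ⟨hz, hmz⟩))).2⟩
    by_cases h2 : T.outIn U m' = T.outIn U k
    · exact ⟨z', by simp, (mem_outIn.1 (hkv (h2 ▸ mem_outIn.2 ⟨hz', hmz'⟩))).2⟩
    exact (h.not_three_incomparable hy (hNR hm) (hNR hm') (hNR hk)
      (hinc _ _ hmm hmm' hne') (hinc _ _ hmm' hmm hne'.symm) (hinc _ _ hmm' hkm h2)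
      (hinc _ _ hkm hmm' (Ne.symm h2)) (hinc _ _ hmm hkm h1)
      (hinc _ _ hkm hmm (Ne.symm h1))).elim

/-- In a light tournament, the apexes of the triangles on an arc `x → y` induce no triangle. -/
lemma Light.not_triangle_of_common_arc (h : T.Light) {x y a b c : V} (hxy : T.Adj x y)
    (ha : T.Adj y a ∧ T.Adj a x) (hb : T.Adj y b ∧ T.Adj b x) (hc : T.Adj y c ∧ T.Adj c x)
    (hab : T.Adj a b) (hbc : T.Adj b c) : ¬ T.Adj c a := fun hca =>
  h.not_two_diagonals hab hbc hca
    (isDiagonal_of_adj hxy ha.1 ha.2 hb.1 hb.2 (ne_of_adj hab))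
    (isDiagonal_of_adj hxy hb.1 hb.2 hc.1 hc.2 (ne_of_adj hbc))

/-- No vertex of `R` has two out-neighbors in a triangle in `U` whose third vertex has an
in-neighbor in `R`. -/
lemma Light.not_adj_two_of_triangle (h : T.Light) {y : V} {U R : Finset V}
    (hy : T.Separates y U R) {a b c v v' : V} (ha : a ∈ U) (hb : b ∈ U) (hc : c ∈ U)
    (hab : T.Adj a b) (hbc : T.Adj b c) (hca : T.Adj c a) (hv : v ∈ R) (hv' : v' ∈ R)
    (hva : T.Adj v a) (hvb : T.Adj v b) (hvc : T.Adj v' c) : False := by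
  have tri : ∀ x ∈ R, T.Adj x a → T.Adj x b → ¬ T.Adj x c := fun x hx h1 h2 h3 =>
    h.not_triangle_of_common_arc (hy.2 x hx) ⟨h1, hy.1 a ha⟩ ⟨h2, hy.1 b hb⟩ ⟨h3, hy.1 c hc⟩
      hab hbc hca
  have hcv := hy.adj_of_not_adj hc hv (tri v hv hva hvb)
  have hne : v ≠ v' := by
    rintro rfl
    exact T.asymm hcv hvc
  -- Here c → v → a, b and v' → c. In each orientation of v v', a vertex of the triangle missed by
  -- v' makes the pair incomparable, and the forced arc inside U reverses an arc of the triangle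
  -- abc.
  rcases T.total (T.adj_left hva) (T.adj_left hvc) hne with hvv | hvv
  · by_cases hva' : T.Adj v' a
    · have hbv := hy.adj_of_not_adj hb hv' fun hvb' => tri v' hv' hva' hvb' hvc
      exact T.asymm hab (h.adj_common hvv hvb hbv hvc hcv (hy.1 b hb) (hy.1 c hc)
        (hy.2 v hv) (hy.2 v' hv') (hy.1 a ha) hva hva')
    · exact T.asymm hca (h.adj_and_diagonals hvv hva (hy.adj_of_not_adj ha hv' hva') hvc hcv
        (hy.1 a ha) (hy.1 c hc) (hy.2 v hv) (hy.2 v' hv')).1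
  · by_cases hvb' : T.Adj v' b
    · have hav := hy.adj_of_not_adj ha hv' fun hva' => tri v' hv' hva' hvb' hvc
      exact T.asymm hbc (h.adj_common hvv hvc hcv hva hav (hy.1 c hc) (hy.1 a ha)
        (hy.2 v' hv') (hy.2 v hv) (hy.1 b hb) hvb' hvb)
    · exact T.asymm hbc (h.adj_and_diagonals hvv hvc hcv hvb (hy.adj_of_not_adj hb hv' hvb')
        (hy.1 c hc) (hy.1 b hb) (hy.2 v' hv') (hy.2 v hv)).1

/-- If every vertex of `U` has an in-neighbor in `R`, then `U` contains no triangle. -/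
lemma Light.not_triangle_of_covered (h : T.Light) {y : V} {U R : Finset V}
    (hy : T.Separates y U R) (hcov : ∀ u ∈ U, ∃ v ∈ R, T.Adj v u) {a b c : V}
    (ha : a ∈ U) (hb : b ∈ U) (hc : c ∈ U) (hab : T.Adj a b) (hbc : T.Adj b c) :
    ¬ T.Adj c a := by
  intro hca
  obtain ⟨p, hp, hpa⟩ := hcov a ha
  obtain ⟨q, hq, hqb⟩ := hcov b hb
  obtain ⟨r, hr, hrc⟩ := hcov c hc
  -- No vertex of R has arcs to two of a, b, c. So p, q, r each see exactly one of them and have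
  -- pairwise incomparable out-neighborhoods.
  have nab : ∀ x ∈ R, T.Adj x a → ¬ T.Adj x b := fun x hx h1 h2 =>
    h.not_adj_two_of_triangle hy ha hb hc hab hbc hca hx hr h1 h2 hrc
  have nbc : ∀ x ∈ R, T.Adj x b → ¬ T.Adj x c := fun x hx h1 h2 =>
    h.not_adj_two_of_triangle hy hb hc ha hbc hca hab hx hp h1 h2 hpa
  have nca : ∀ x ∈ R, T.Adj x c → ¬ T.Adj x a := fun x hx h1 h2 =>
    h.not_adj_two_of_triangle hy hc ha hb hca hab hbc hx hq h1 h2 hqb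
  have inc : ∀ {x v v'}, x ∈ U → T.Adj v x → ¬ T.Adj v' x →
      ¬ T.outIn U v ⊆ T.outIn U v' := fun hx hv hv' hs =>
    hv' (mem_outIn.1 (hs (mem_outIn.2 ⟨hx, hv⟩))).2
  exact h.not_three_incomparable hy hp hq hr
    (inc ha hpa fun k => nab q hq k hqb) (inc hb hqb (nab p hp hpa))
    (inc hb hqb fun k => nbc r hr k hrc) (inc hc hrc (nbc q hq hqb))
    (inc ha hpa (nca r hr hrc)) (inc hc hrc fun k => nca p hp k hpa)

end LightLayers
-- The linear relaxations.
section Relaxations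

variable {V : Type*} {T : Tournament V}

lemma objective_third (T : Tournament V) (w : V → ℝ) :
    T.objective w (fun _ => 1 / 3) = 1 / 3 * weight w T.verts := by
  rw [objective, weight, mul_sum]
  exact sum_congr rfl fun _ _ => by ring

variable [DecidableEq V]

/-- If no coordinate outside `Y` of a point of `SA₁(T)` reaches `3/7`, then `T - Y` is light. -/
lemma light_delete_of_mem_SA1Polytope {x : V → ℝ} (hx : x ∈ T.SA1Polytope) {Y : Finset V}
    (hY : ∀ v ∈ (T.delete Y).verts, x v < 3 / 7) : (T.delete Y).Light := by
  obtain ⟨-, y, -, hy⟩ := hx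
  -- Covering of b by the triangle uva gives x_b ≤ x_ub + x_vb + x_ab, and the triangle uvb gives 1
  -- + x_ub + x_vb ≤ x_u + x_v + x_b. Adding them bounds x_ab below by 1 - x_u - x_v.
  have key : ∀ a b, (T.delete Y).IsDiagonal a b → 1 / 7 < y s(a, b) := by
    rintro a b ⟨hne, u, v, hta, htb⟩
    have hu := hY u (triangle_subset_verts hta (by simp))
    have hv := hY v (triangle_subset_verts hta (by simp))
    have hta' := (mem_triangles_delete.1 hta).1
    have htb' := (mem_triangles_delete.1 htb).1
    have hn := ne_of_mem_triangles htb'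
    have h1 := ((hy u v a hta').2 b (triangle_subset_verts htb' (by simp)) hn.2.2.symm
      hn.2.1.symm hne.symm).1
    rw [pair_comm] at htb'
    have h2 := (hy u b v htb').1
    rw [Sym2.eq_swap (a := b) (b := v)] at h2
    linarith
  rintro t ⟨ht, a, b, c, rfl, hab, hbc⟩
  have ha := hY a (triangle_subset_verts ht (by simp))
  have hb := hY b (triangle_subset_verts ht (by simp))
  have hc := hY c (triangle_subset_verts ht (by simp))
  have h := (hy a b c (mem_triangles_delete.1 ht).1).1
  have h1 := key a b hab
  have h2 := key b c hbc
  linarith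

lemma third_mem_SA0Polytope : (fun _ => 1 / 3 : V → ℝ) ∈ T.SA0Polytope :=
  ⟨fun _ _ => by norm_num, fun _ _ _ _ => by norm_num⟩

lemma IsOptimal.SA0_eq {w x : V → ℝ} (h : T.IsOptimal w T.SA0Polytope x) :
    T.SA0 w = T.objective w x :=
  IsLeast.csInf_eq ⟨⟨x, h.1, rfl⟩, by
    rintro _ ⟨y, hy, rfl⟩
    exact h.2 y hy⟩

/-- If an optimal solution of the basic relaxation has all coordinates strictly between `0` and
`1/2`, then the point with all coordinates `1/3` is optimal too. -/
lemma IsOptimal.objective_eq {w x : V → ℝ} (h : T.IsOptimal w T.SA0Polytope x)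
    (hpos : ∀ v ∈ T.verts, 0 < x v) (hlt : ∀ v ∈ T.verts, x v < 1 / 2) :
    T.objective w x = 1 / 3 * weight w T.verts := by
  rw [← objective_third T]
  refine le_antisymm (h.2 _ third_mem_SA0Polytope) ?_
  obtain ⟨ε, hε, hεx⟩ : ∃ ε > 0, ∀ v ∈ T.verts, ε ≤ x v := by
    rcases T.verts.eq_empty_or_nonempty with he | hne
    · exact ⟨1, one_pos, by simp [he]⟩
    · obtain ⟨v, hv, hmin⟩ := T.verts.exists_min_image x hne
      exact ⟨x v, hpos v hv, hmin⟩
  -- Moving away from 1/3 cannot push a triangle sum below 1, since the constant point makes all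
  -- triangle constraints tight. The bounds ε ≤ x_v < 1/2 keep the coordinates in [0, 1].
  have hmem : (fun v => x v + ε * (x v - 1 / 3)) ∈ T.SA0Polytope := by
    refine ⟨fun v hv => ?_, fun a b c ht => ?_⟩
    · have h1 := hεx v hv
      have h2 := hlt v hv
      constructor <;> nlinarith
    · have h1 := h.1.2 a b c ht
      nlinarith
  have hle := h.2 _ hmem
  have heq : T.objective w (fun v => x v + ε * (x v - 1 / 3)) =
      T.objective w x + ε * (T.objective w x - T.objective w (fun _ => 1 / 3)) := by
    simp only [objective]
    rw [← sum_sub_distrib, mul_sum, ← sum_add_distrib]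
    exact sum_congr rfl fun _ _ => by ring
  rw [heq] at hle
  by_contra hcon
  nlinarith

lemma SA0_eq_of_verts_eq_empty (w : V → ℝ) (h : T.verts = ∅) : T.SA0 w = 0 := by
  have : T.objective w '' T.SA0Polytope = {0} := by
    refine Set.eq_singleton_iff_unique_mem.2 ⟨⟨_, third_mem_SA0Polytope, ?_⟩, ?_⟩
    · simp [objective, h]
    · rintro _ ⟨x, -, rfl⟩
      simp [objective, h]
  rw [SA0, this, csInf_singleton]

/-- The indicator vector of a feedback vertex set is feasible. -/
lemma SA0_le_weight {w : V → ℝ} (hw : ∀ v ∈ T.verts, 0 ≤ w v) {X : Finset V}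
    (hX : T.IsFVS X) : T.SA0 w ≤ weight w X := by
  have hmem : (fun v => if v ∈ X then 1 else 0 : V → ℝ) ∈ T.SA0Polytope := by
    refine ⟨fun v _ => by dsimp only; split_ifs <;> norm_num, fun a b c ht => ?_⟩
    have h := hX.not_disjoint ht
    simp only [disjoint_insert_left, disjoint_singleton_left] at h
    dsimp only
    split_ifs <;> norm_num
    tauto
  have hobj : T.objective w (fun v => if v ∈ X then 1 else 0) = weight w X := by
    simp only [objective, weight, mul_ite, mul_one, mul_zero]
    rw [← sum_filter, filter_mem_eq_inter, inter_eq_right.2 hX.1]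
  rw [← hobj]
  refine csInf_le ⟨0, ?_⟩ ⟨_, hmem, rfl⟩
  rintro _ ⟨x, hx, rfl⟩
  exact sum_nonneg fun v hv => mul_nonneg (hw v hv) (hx.1 v hv).1

end Relaxations

/-! ### Invariants and result of the rounding phase. -/

section Rounding

variable {V : Type*} {T : Tournament V}

lemma mem_vertsAbove {x : V → ℝ} {c : ℝ} {v : V} :
    v ∈ T.vertsAbove x c ↔ v ∈ T.verts ∧ c ≤ x v := by
  simp [vertsAbove]

variable [DecidableEq V]

lemma mem_triangleFreeVerts {v : V} :
    v ∈ T.triangleFreeVerts ↔ v ∈ T.verts ∧ ∀ t ∈ T.triangles, v ∉ t := by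
  simp [triangleFreeVerts]

/-- The properties of the sets `F` and `Z` that the rounding phase maintains. -/
structure RoundingInvariant (T : Tournament V) (F Z : Finset V) : Prop where
  subset : F ⊆ T.verts
  disjoint : ∀ t ∈ T.triangles, Disjoint t F → Disjoint t Z
  exists_SA1 : ∃ x ∈ T.SA1Polytope, T.vertsAbove x (3 / 7) ⊆ F

lemma RoundingInvariant.iterate {w x : V → ℝ} {F Z F' Z' : Finset V}
    (h : T.RoundingInvariant F Z) (hit : T.RoundingIteration w F Z x F' Z') :
    T.RoundingInvariant F' Z' := by
  have hF : F ⊆ F' := hit.F_eq ▸ subset_union_left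
  refine ⟨?_, fun t ht hd => ?_, ?_⟩
  · rw [hit.F_eq]
    refine union_subset h.subset fun v hv => ?_
    have := (mem_vertsAbove.1 hv).1
    rw [delete_verts] at this
    exact (mem_sdiff.1 this).1
  · have hd' := hd.mono_right hF
    have hZ := h.disjoint t ht hd'
    rw [hit.Z_eq, disjoint_union_right]
    refine ⟨hZ, disjoint_left.2 fun v hv hv' => ?_⟩
    exact (mem_triangleFreeVerts.1 hv').2 t
      (mem_triangles_delete.2 ⟨ht, disjoint_union_right.2 ⟨hd', hZ⟩⟩) hv
  · obtain ⟨x, hx, hxF⟩ := h.exists_SA1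
    exact ⟨x, hx, hxF.trans hF⟩

lemma RoundingState.invariant {w : V → ℝ} {F Z : Finset V} (h : T.RoundingState w F Z) :
    T.RoundingInvariant F Z := by
  induction h with
  | init x hx _ =>
    exact ⟨fun v hv => (mem_vertsAbove.1 hv).1, fun t _ _ => disjoint_empty_right t,
      x, hx.1, subset_rfl⟩
  | next F Z x F' Z' _ hit _ ih => exact ih.iterate hit

lemma RoundingInvariant.light {F Z : Finset V} (h : T.RoundingInvariant F Z) :
    (T.delete (F ∪ Z)).Light := by
  obtain ⟨x, hx, hxF⟩ := h.exists_SA1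
  refine light_delete_of_mem_SA1Polytope hx fun v hv => ?_
  rw [delete_verts, mem_sdiff, mem_union] at hv
  by_contra hcon
  exact hv.2 (.inl (hxF (mem_vertsAbove.2 ⟨hv.1, not_lt.1 hcon⟩)))

/-- A triangle that avoids F also avoids Z. It therefore survives in the residual tournament and is
hit there. -/
lemma RoundingInvariant.isFVS_union {F Z F' : Finset V} (h : T.RoundingInvariant F Z)
    (hF' : (T.delete (F ∪ Z)).IsFVS F') : T.IsFVS (F ∪ F') := by
  refine isFVS_of_not_disjoint (union_subset h.subset ?_) fun t ht hd => ?_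
  · have := hF'.1
    rw [delete_verts] at this
    exact this.trans sdiff_subset
  · rw [disjoint_union_right] at hd
    exact hF'.not_disjoint (mem_triangles_delete.2
      ⟨ht, disjoint_union_right.2 ⟨hd.1, h.disjoint t ht hd.1⟩⟩) hd.2

lemma RoundingOutput.invariant {w : V → ℝ} {F Z : Finset V} (h : T.RoundingOutput w F Z) :
    T.RoundingInvariant F Z := by
  obtain ⟨F₀, Z₀, x, hst, hit, -⟩ := h
  exact hst.invariant.iterate hit

/-- The rounding phase ends with an empty tournament or with a tournament all of whose vertices
lie in triangles and that has an optimal solution with all coordinates smaller than `1/2`. -/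
lemma RoundingOutput.verts_eq_empty_or {w : V → ℝ} {F Z : Finset V}
    (h : T.RoundingOutput w F Z) :
    (T.delete (F ∪ Z)).verts = ∅ ∨
      (∀ v ∈ (T.delete (F ∪ Z)).verts, ∃ t ∈ (T.delete (F ∪ Z)).triangles, v ∈ t) ∧
      ∃ x, (T.delete (F ∪ Z)).IsOptimal w (T.delete (F ∪ Z)).SA0Polytope x ∧
        ∀ v ∈ (T.delete (F ∪ Z)).verts, x v < 1 / 2 := by
  obtain ⟨F₀, Z₀, x, -, hit, hlast⟩ := h
  refine hlast.imp_right fun hx => ?_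
  -- The last iteration rounded nothing up, so only triangle-free vertices were deleted. Triangles
  -- present before that deletion survive it.
  have hF : F = F₀ := by
    rw [hit.F_eq, union_eq_left]
    intro v hv
    obtain ⟨hv, hxv⟩ := mem_vertsAbove.1 hv
    exact absurd hxv (hx v hv).not_ge
  subst hF
  refine ⟨fun v hv => ?_, x, hit.optimal, hx⟩
  rw [delete_verts, mem_sdiff, mem_union, not_or, hit.Z_eq, mem_union, not_or,
    mem_triangleFreeVerts] at hv
  obtain ⟨hvT, hvF, hvZ, hv⟩ := hv
  have hv₀ : v ∈ (T.delete (F ∪ Z₀)).verts := by simp [delete_verts, hvT, hvF, hvZ]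
  simp only [hv₀, true_and, not_forall, not_not] at hv
  obtain ⟨t, ht, hvt⟩ := hv
  obtain ⟨ht', hd⟩ := mem_triangles_delete.1 ht
  rw [disjoint_union_right] at hd
  refine ⟨t, mem_triangles_delete.2 ⟨ht', ?_⟩, hvt⟩
  rw [hit.Z_eq, disjoint_union_right, disjoint_union_right]
  exact ⟨hd.1, hd.2, disjoint_left.2 fun a hat ha => (mem_triangleFreeVerts.1 ha).2 t ht hat⟩

lemma RoundingOutput.exists_triangle {w : V → ℝ} {F Z : Finset V}
    (h : T.RoundingOutput w F Z) :
    ∀ v ∈ (T.delete (F ∪ Z)).verts, ∃ t ∈ (T.delete (F ∪ Z)).triangles, v ∈ t := by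
  rcases h.verts_eq_empty_or with he | ⟨ht, -⟩
  · simp [he]
  · exact ht

lemma RoundingOutput.SA0_eq {w : V → ℝ} {F Z : Finset V} (h : T.RoundingOutput w F Z) :
    (T.delete (F ∪ Z)).SA0 w = 1 / 3 * weight w (T.delete (F ∪ Z)).verts := by
  rcases h.verts_eq_empty_or with he | ⟨htri, x, hx, hlt⟩
  · simp [SA0_eq_of_verts_eq_empty w he, he, weight]
  · rw [hx.SA0_eq]
    -- Positivity: the other two coordinates of a triangle through v add up to less than 1.
    refine hx.objective_eq (fun v hv => ?_) hlt
    obtain ⟨t, ht, hvt⟩ := htri v hv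
    have hsub := triangle_subset_verts ht
    obtain ⟨a, b, c, rfl, -⟩ := id ht
    have h1 := hx.1.2 a b c ht
    have ha := hlt a (hsub (by simp))
    have hb := hlt b (hsub (by simp))
    have hc := hlt c (hsub (by simp))
    simp only [mem_insert, mem_singleton] at hvt
    rcases hvt with rfl | rfl | rfl <;> linarith

end Rounding
end Tournament

/-! ### Weights of unions. -/

lemma weight_union_of_disjoint {V : Type*} [DecidableEq V] {w : V → ℝ} {X Y : Finset V}
    (h : Disjoint X Y) : weight w (X ∪ Y) = weight w X + weight w Y :=
  sum_union h

lemma weight_nonneg {V : Type*} {w : V → ℝ} {X Y : Finset V} (hw : ∀ v ∈ Y, 0 ≤ w v)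
    (h : X ⊆ Y) : 0 ≤ weight w X :=
  sum_nonneg fun v hv => hw v (h hv)

lemma weight_mono {V : Type*} {w : V → ℝ} {X Y : Finset V} (hw : ∀ v ∈ Y, 0 ≤ w v)
    (h : X ⊆ Y) : weight w X ≤ weight w Y :=
  sum_le_sum_of_subset_of_nonneg h fun v hv _ => hw v hv

lemma weight_union_le {V : Type*} [DecidableEq V] {w : V → ℝ} {X Y : Finset V}
    (hw : ∀ v ∈ Y, 0 ≤ w v) : weight w (X ∪ Y) ≤ weight w X + weight w Y := by
  rw [← union_sdiff_self_eq_union, weight_union_of_disjoint disjoint_sdiff]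
  exact add_le_add_right (weight_mono hw sdiff_subset) _

lemma weight_biUnion_le {V ι : Type*} [DecidableEq V] {w : V → ℝ} {I : Finset ι}
    {f : ι → Finset V} (hw : ∀ i ∈ I, ∀ v ∈ f i, 0 ≤ w v) :
    weight w (I.biUnion f) ≤ ∑ i ∈ I, weight w (f i) := by
  classical
  induction I using Finset.induction_on with
  | empty => simp [weight]
  | insert i I hi ih =>
    rw [biUnion_insert, sum_insert hi]
    refine (weight_union_le fun v hv => ?_).trans
      (add_le_add_right (ih fun j hj => hw j (mem_insert_of_mem hj)) _)
    obtain ⟨j, hj, hv⟩ := mem_biUnion.1 hv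
    exact hw j (mem_insert_of_mem hj) v hv

namespace Tournament

/-! ### The subroutine on triangle-free sets. -/

section TriangleFreeSets

variable {V : Type*} {T : Tournament V}

/-- The set `X` contains no directed triangle. -/
def NoTriangleIn (T : Tournament V) (X : Finset V) : Prop :=
  ∀ a ∈ X, ∀ b ∈ X, ∀ c ∈ X, T.Adj a b → T.Adj b c → ¬ T.Adj c a

variable [DecidableEq V]

lemma NoTriangleIn.isFVS_empty {X : Finset V} (h : T.NoTriangleIn X) :
    (T.induce X).IsFVS ∅ :=
  isFVS_iff.2 ⟨empty_subset _, fun a b c _ _ _ hab hbc hca =>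
    h a hab.2.1 b hbc.2.1 c hca.2.1 hab.1 hbc.1 hca.1⟩

lemma NoTriangleIn.t5Free {X : Finset V} (h : T.NoTriangleIn X) : (T.induce X).T5Free := by
  rintro Y - ⟨-, -, hlow⟩
  have hY : (T.induce X).NoTriangleIn Y := fun a _ b _ c _ hab hbc hca =>
    h a hab.2.1 b hbc.2.1 c hca.2.1 hab.1 hbc.1 hca.1
  have := hlow ⟨∅, hY.isFVS_empty, card_empty⟩
  omega

lemma NoTriangleIn.cdzAnswer_empty {w : V → ℝ} (hw : ∀ v ∈ T.verts, 0 ≤ w v) {X : Finset V}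
    (h : T.NoTriangleIn X) : (T.induce X).CDZAnswer w ∅ := by
  refine fun _ => ⟨h.isFVS_empty, fun Y hY => ?_⟩
  exact weight_nonneg hw (hY.1.trans inter_subset_left)

/-- A triangle-free input is `T5Free`, so the answer is optimal and costs no more than the empty
feedback vertex set. -/
lemma NoTriangleIn.of_cdzAnswer {w : V → ℝ} {X C : Finset V} (h : T.NoTriangleIn X)
    (hC : (T.induce X).CDZAnswer w C) : C ⊆ X ∧ weight w C ≤ 0 := by
  obtain ⟨hfvs, hmin⟩ := hC h.t5Free
  exact ⟨hfvs.1.trans inter_subset_right, hmin ∅ h.isFVS_empty⟩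

end TriangleFreeSets

/-! ### Invariants and termination of the layering algorithm. -/

section Layers

variable {V : Type*} {T : Tournament V}

/-- The current root layer is empty or separated from the unseen vertices by a vertex. -/
def SeparatedRoot (T : Tournament V) (s : LayersState V) : Prop :=
  s.U s.i = ∅ ∨ ∃ y, T.Separates y (s.U s.i) s.W

lemma SeparatedRoot.exists_separates {s : LayersState V} (h : T.SeparatedRoot s) {z : V}
    (hz : z ∈ s.U s.i) : ∃ y, T.Separates y (s.U s.i) s.W :=
  h.resolve_left (ne_empty_of_mem hz)

variable [DecidableEq V]

lemma mem_inNbhd {S : Finset V} {v : V} :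
    v ∈ T.inNbhd S ↔ v ∈ T.verts ∧ v ∉ S ∧ ∃ u ∈ S, T.Adj v u := by
  simp [inNbhd]

lemma mem_inNbhd_singleton {v z : V} : v ∈ T.inNbhd {z} ↔ T.Adj v z := by
  simp only [mem_inNbhd, mem_singleton, exists_eq_left]
  exact ⟨fun h => h.2.2, fun h => ⟨T.adj_left h, ne_of_adj h, h⟩⟩

/-- A layer `U ∪ S` with a local solution `F` that the analysis can handle. -/
structure IsGoodLayer (T : Tournament V) (w : V → ℝ) (U S F : Finset V) : Prop where
  S_subset : S ⊆ F
  F_subset : F ⊆ U ∪ S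
  weight_le : 2 * weight w F ≤ weight w (U ∪ S)
  noTriangle : T.NoTriangleIn U

/-- Append the layer `A ∪ B` with local solution `C`. -/
def LayersState.extend (s : LayersState V) (A B C : Finset V) : LayersState V where
  i := s.i + 1
  U := Function.update s.U (s.i + 1) A
  S := Function.update s.S (s.i + 1) B
  F := Function.update s.F (s.i + 1) C
  W := s.W \ (A ∪ B)

/-- The properties of the layers built so far. -/
structure LayersInvariant (T : Tournament V) (w : V → ℝ) (s : LayersState V) : Prop where
  W_subset : s.W ⊆ T.verts
  layer_subset : ∀ j ≤ s.i, s.U j ∪ s.S j ⊆ T.verts \ s.W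
  disjoint : ∀ j ≤ s.i, ∀ k ≤ s.i, j < k → Disjoint (s.U j ∪ s.S j) (s.U k ∪ s.S k)
  cover : ∀ v ∈ T.verts, v ∉ s.W → ∃ j ≤ s.i, v ∈ s.U j ∪ s.S j
  adj_unseen : ∀ j < s.i, ∀ u ∈ s.U j, ∀ v ∈ s.W, T.Adj u v
  adj : ∀ j k, j + 2 ≤ k → k ≤ s.i → ∀ u ∈ s.U j, ∀ v ∈ s.U k, T.Adj u v
  good : ∀ j ≤ s.i, T.IsGoodLayer w (s.U j) (s.S j) (s.F j)

lemma LayersInvariant.init (w : V → ℝ) : T.LayersInvariant w T.layersInit := by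
  refine ⟨subset_rfl, ?_, ?_, ?_, ?_, ?_, ?_⟩
  · simp [layersInit]
  · simp [layersInit]
  · exact fun v hv h => absurd hv h
  · simp [layersInit]
  · simp [layersInit]
  · exact fun _ _ => ⟨subset_rfl, by simp [layersInit], by simp [layersInit, weight],
      by simp [layersInit, NoTriangleIn]⟩

/-- Only the current root layer still needs arcs to all remaining vertices. Older layers have them
already, which yields the forward arcs between layers at distance at least 2. -/
lemma LayersInvariant.extend {w : V → ℝ} {s : LayersState V} (h : T.LayersInvariant w s)
    {A B C : Finset V} (hgood : T.IsGoodLayer w A B C) (hsub : A ∪ B ⊆ s.W)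
    (hadj : ∀ u ∈ s.U s.i, ∀ v ∈ s.W \ (A ∪ B), T.Adj u v) :
    T.LayersInvariant w (s.extend A B C) := by
  have old : ∀ j ≤ s.i, j ≠ s.i + 1 := fun j hj => by omega
  refine ⟨sdiff_subset.trans h.W_subset, fun j hj => ?_, fun j hj k hk hjk => ?_,
    fun v hv hvW => ?_, fun j hj => ?_, fun j k hjk hk => ?_, fun j hj => ?_⟩ <;>
    simp only [LayersState.extend] at *
  · rcases Nat.le_succ_iff.1 hj with hj | rfl
    · rw [Function.update_of_ne (old j hj), Function.update_of_ne (old j hj)]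
      exact (h.layer_subset j hj).trans (sdiff_subset_sdiff subset_rfl sdiff_subset)
    · rw [Function.update_self, Function.update_self]
      exact fun v hv => mem_sdiff.2 ⟨h.W_subset (hsub hv), fun h' => (mem_sdiff.1 h').2 hv⟩
  · have hj' : j ≤ s.i := by omega
    rw [Function.update_of_ne (old j hj'), Function.update_of_ne (old j hj')]
    rcases Nat.le_succ_iff.1 hk with hk | rfl
    · rw [Function.update_of_ne (old k hk), Function.update_of_ne (old k hk)]
      exact h.disjoint j hj' k hk hjk
    · rw [Function.update_self, Function.update_self]
      exact disjoint_left.2 fun v hv hv' =>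
        (mem_sdiff.1 (h.layer_subset j hj' hv)).2 (hsub hv')
  · by_cases hvW' : v ∈ s.W
    · refine ⟨s.i + 1, le_rfl, ?_⟩
      rw [Function.update_self, Function.update_self]
      by_contra hcon
      exact hvW (mem_sdiff.2 ⟨hvW', hcon⟩)
    · obtain ⟨j, hj, hvj⟩ := h.cover v hv hvW'
      refine ⟨j, by omega, ?_⟩
      rwa [Function.update_of_ne (old j hj), Function.update_of_ne (old j hj)]
  · have hj' : j ≤ s.i := by omega
    rw [Function.update_of_ne (old j hj')]
    intro u hu v hv
    rcases hj'.lt_or_eq with hlt | rfl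
    · exact h.adj_unseen j hlt u hu v (mem_sdiff.1 hv).1
    · exact hadj u hu v hv
  · have hj' : j ≤ s.i := by omega
    rw [Function.update_of_ne (old j hj')]
    rcases Nat.le_succ_iff.1 hk with hk | rfl
    · rw [Function.update_of_ne (old k hk)]
      exact h.adj j k hjk hk
    · rw [Function.update_self]
      exact fun u hu v hv =>
        h.adj_unseen j (by omega) u hu v (hsub (mem_union_left _ hv))
  · rcases Nat.le_succ_iff.1 hj with hj | rfl
    · rw [Function.update_of_ne (old j hj), Function.update_of_ne (old j hj),
        Function.update_of_ne (old j hj)]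
      exact h.good j hj
    · rwa [Function.update_self, Function.update_self, Function.update_self]

lemma LayersInvariant.adj_of_not_mem_inNbhd {w : V → ℝ} {s : LayersState V}
    (h : T.LayersInvariant w s) {u v : V} (hu : u ∈ s.U s.i) (hv : v ∈ s.W)
    (hN : v ∉ T.inNbhd (s.U s.i) ∩ s.W) : T.Adj u v := by
  have hsub := h.layer_subset s.i le_rfl
  have hu' := mem_sdiff.1 (hsub (mem_union_left _ hu))
  have hvU : v ∉ s.U s.i := fun h' => (mem_sdiff.1 (hsub (mem_union_left _ h'))).2 hv
  refine adj_of_not_adj (h.W_subset hv) hu'.1 ?_ fun hvu => hN ?_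
  · rintro rfl
    exact hvU hu
  · exact mem_inter.2 ⟨mem_inNbhd.2 ⟨h.W_subset hv, hvU, u, hu, hvu⟩, hv⟩

/-- All vertices of the new U are apexes on the arc z → y, so it is triangle-free. The weight order
of z and z' gives w(S) ≤ w(U), and z separates the new root layer from the rest. -/
lemma LayersInvariant.grow {w : V → ℝ} (hw : ∀ v ∈ T.verts, 0 ≤ w v) (hl : T.Light)
    {s : LayersState V} (h : T.LayersInvariant w s) (hs : T.SeparatedRoot s) {z z' : V}
    (hz : z ∈ s.U s.i) (hdom : T.InDominates {z, z'} (T.inNbhd (s.U s.i) ∩ s.W))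
    (hwt : weight w (T.inNbhd {z'} ∩ s.W) ≤ weight w (T.inNbhd {z} ∩ s.W)) :
    (T.inNbhd (s.U s.i) ∩ s.W ⊆ (T.inNbhd {z} ∩ s.W) ∪
        ((T.inNbhd {z'} ∩ s.W) \ (T.inNbhd {z} ∩ s.W))) ∧
    T.LayersInvariant w (s.extend (T.inNbhd {z} ∩ s.W)
      ((T.inNbhd {z'} ∩ s.W) \ (T.inNbhd {z} ∩ s.W))
      ((T.inNbhd {z'} ∩ s.W) \ (T.inNbhd {z} ∩ s.W))) ∧
    T.SeparatedRoot (s.extend (T.inNbhd {z} ∩ s.W)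
      ((T.inNbhd {z'} ∩ s.W) \ (T.inNbhd {z} ∩ s.W))
      ((T.inNbhd {z'} ∩ s.W) \ (T.inNbhd {z} ∩ s.W))) := by
  obtain ⟨y, hy⟩ := hs.exists_separates hz
  have hcov : T.inNbhd (s.U s.i) ∩ s.W ⊆ (T.inNbhd {z} ∩ s.W) ∪
      ((T.inNbhd {z'} ∩ s.W) \ (T.inNbhd {z} ∩ s.W)) := by
    intro v hv
    obtain ⟨x, hx, hvx⟩ := hdom v hv
    rw [union_sdiff_self_eq_union]
    simp only [mem_insert, mem_singleton] at hx
    rcases hx with rfl | rfl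
    · exact mem_union_left _ (mem_inter.2 ⟨mem_inNbhd_singleton.2 hvx, (mem_inter.1 hv).2⟩)
    · exact mem_union_right _ (mem_inter.2 ⟨mem_inNbhd_singleton.2 hvx, (mem_inter.1 hv).2⟩)
  have hA : T.NoTriangleIn (T.inNbhd {z} ∩ s.W) := by
    have key : ∀ v ∈ T.inNbhd {z} ∩ s.W, T.Adj y v ∧ T.Adj v z := fun v hv =>
      ⟨hy.2 v (mem_inter.1 hv).2, mem_inNbhd_singleton.1 (mem_inter.1 hv).1⟩
    exact fun a ha b hb c hc =>
      hl.not_triangle_of_common_arc (hy.1 z hz) (key a ha) (key b hb) (key c hc)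
  generalize hAdef : T.inNbhd {z} ∩ s.W = A at *
  generalize hBdef : T.inNbhd {z'} ∩ s.W = B at *
  have hAW : A ⊆ s.W := hAdef ▸ inter_subset_right
  have hBW : B ⊆ s.W := hBdef ▸ inter_subset_right
  have hadj : ∀ u ∈ s.U s.i, ∀ v ∈ s.W \ (A ∪ B \ A), T.Adj u v := fun u hu v hv =>
    h.adj_of_not_mem_inNbhd hu (mem_sdiff.1 hv).1 fun hN => (mem_sdiff.1 hv).2 (hcov hN)
  refine ⟨hcov, h.extend ⟨subset_rfl, subset_union_right, ?_, hA⟩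
    (union_subset hAW (sdiff_subset.trans hBW)) hadj, .inr ⟨z, ?_, ?_⟩⟩
  · have hB : weight w (B \ A) ≤ weight w B :=
      weight_mono (fun v hv => hw v (h.W_subset (hBW hv))) sdiff_subset
    rw [weight_union_of_disjoint disjoint_sdiff]
    linarith
  · simp only [LayersState.extend, Function.update_self]
    intro u hu
    rw [← hAdef] at hu
    exact mem_inNbhd_singleton.1 (mem_inter.1 hu).1
  · exact hadj z hz

lemma separates_inNbhd {W : Finset V} {z : V} (hW : W ⊆ T.verts) (hz : z ∈ W) :
    T.Separates z (T.inNbhd {z} ∩ W) (W \ ({z} ∪ (T.inNbhd {z} ∩ W))) := by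
  refine ⟨fun u hu => mem_inNbhd_singleton.1 (mem_inter.1 hu).1, fun v hv => ?_⟩
  simp only [mem_sdiff, mem_union, mem_singleton, mem_inter, mem_inNbhd_singleton, not_or,
    not_and] at hv
  exact adj_of_not_adj (hW hv.1) (hW hz) hv.2.1 fun h => hv.2.2 h hv.1

/-- The in-neighborhood of a vertex of minimum in-degree contains no triangle. -/
lemma Light.noTriangleIn_inNbhd (hl : T.Light) {W : Finset V} {z : V} (hW : W ⊆ T.verts)
    (hz : z ∈ W) (hmin : ∀ v ∈ W, (T.inNbhd {z} ∩ W).card ≤ (T.inNbhd {v} ∩ W).card) :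
    T.NoTriangleIn (T.inNbhd {z} ∩ W) := by
  have hcov : ∀ u ∈ T.inNbhd {z} ∩ W,
      ∃ v ∈ W \ ({z} ∪ (T.inNbhd {z} ∩ W)), T.Adj v u := by
    intro u hu
    by_contra! hcon
    have huz := mem_inNbhd_singleton.1 (mem_inter.1 hu).1
    have hsub : T.inNbhd {u} ∩ W ⊆ (T.inNbhd {z} ∩ W).erase u := by
      intro v hv
      obtain ⟨hvu, hvW⟩ := mem_inter.1 hv
      rw [mem_inNbhd_singleton] at hvu
      refine mem_erase.2 ⟨ne_of_adj hvu, ?_⟩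
      by_contra hvN
      refine hcon v (mem_sdiff.2 ⟨hvW, ?_⟩) hvu
      rw [mem_union, mem_singleton, not_or]
      refine ⟨?_, hvN⟩
      rintro rfl
      exact T.asymm huz hvu
    have h1 := card_le_card hsub
    have h2 := card_erase_lt_of_mem hu
    have h3 := hmin u (mem_inter.1 hu).2
    omega
  exact fun a ha b hb c hc => hl.not_triangle_of_covered (separates_inNbhd hW hz) hcov ha hb hc

/-- A fresh start appends two layers: {z}, to which every remaining vertex outside N(z) is an
out-neighbor, and the triangle-free N(z), where the subroutine costs nothing. -/
lemma LayersInvariant.fresh {w : V → ℝ} (hw : ∀ v ∈ T.verts, 0 ≤ w v) (hl : T.Light)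
    {s : LayersState V} (h : T.LayersInvariant w s) {z : V} {C : Finset V}
    (hN : T.inNbhd (s.U s.i) ∩ s.W = ∅) (hz : z ∈ s.W)
    (hmin : ∀ v ∈ s.W, (T.inNbhd {z} ∩ s.W).card ≤ (T.inNbhd {v} ∩ s.W).card)
    (hC : (T.induce (T.inNbhd {z} ∩ s.W)).CDZAnswer w C) :
    T.LayersInvariant w ((s.extend {z} ∅ ∅).extend (T.inNbhd {z} ∩ s.W) ∅ C) := by
  have htri := hl.noTriangleIn_inNbhd h.W_subset hz hmin
  obtain ⟨hCsub, hCw⟩ := htri.of_cdzAnswer hC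
  have hsep := separates_inNbhd h.W_subset hz
  refine (h.extend ⟨subset_rfl, empty_subset _, ?_, ?_⟩ ?_ ?_).extend
    ⟨empty_subset _, ?_, ?_, htri⟩ ?_ ?_
  · simpa [weight] using hw z (h.W_subset hz)
  · intro a ha b hb c _ hab
    rw [mem_singleton] at ha hb
    exact absurd (ha.trans hb.symm) (ne_of_adj hab)
  · simpa using hz
  · exact fun u hu v hv => h.adj_of_not_mem_inNbhd hu (mem_sdiff.1 hv).1 (by simp [hN])
  · simpa using hCsub
  · have : 0 ≤ weight w (T.inNbhd {z} ∩ s.W ∪ ∅) := by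
      rw [union_empty]
      exact weight_nonneg hw (inter_subset_right.trans h.W_subset)
    linarith
  · intro v hv
    rw [union_empty] at hv
    simp only [LayersState.extend, union_empty, mem_sdiff, mem_singleton]
    exact ⟨(mem_inter.1 hv).2, ne_of_adj (hsep.1 v hv)⟩
  · simp only [LayersState.extend, union_empty, Function.update_self, mem_singleton]
    rintro u rfl v hv
    rw [sdiff_sdiff_left] at hv
    exact hsep.2 v hv

lemma LayersStep.invariant {w : V → ℝ} (hw : ∀ v ∈ T.verts, 0 ≤ w v) (hl : T.Light)
    {s s' : LayersState V} (hstep : T.LayersStep w s s') (h : T.LayersInvariant w s)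
    (hs : T.SeparatedRoot s) :
    T.LayersInvariant w s' ∧ T.SeparatedRoot s' ∧ s'.W.card < s.W.card := by
  cases hstep with
  | grow z z' hW hN hz hz' hdom hwt =>
    obtain ⟨hcov, hinv, hsep⟩ := h.grow hw hl hs hz hdom hwt
    refine ⟨hinv, hsep, card_lt_card ?_⟩
    obtain ⟨v, hv⟩ := hN
    exact sdiff_subset.ssubset_of_ne fun heq =>
      (mem_sdiff.1 (heq.symm ▸ (mem_inter.1 hv).2)).2 (hcov hv)
  | fresh z C hN hz hmin hC =>
    have hinv := h.fresh hw hl hN hz hmin hC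
    refine ⟨?_, .inr ⟨z, ?_⟩, card_lt_card ?_⟩
    · have hW : (s.W \ ({z} ∪ ∅)) \ (T.inNbhd {z} ∩ s.W ∪ ∅) =
          s.W \ ({z} ∪ (T.inNbhd {z} ∩ s.W)) := by
        rw [union_empty, union_empty, sdiff_sdiff_left, sup_eq_union]
      rw [← hW]
      exact hinv
    · simpa only [Function.update_self] using separates_inNbhd h.W_subset hz
    · exact sdiff_subset.ssubset_of_ne fun heq =>
        (mem_sdiff.1 (heq.symm ▸ hz)).2 (by simp)

lemma LayersReach.invariant {w : V → ℝ} (hw : ∀ v ∈ T.verts, 0 ≤ w v) (hl : T.Light)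
    {n : ℕ} {s : LayersState V} (h : T.LayersReach w n s) :
    T.LayersInvariant w s ∧ T.SeparatedRoot s ∧ n + s.W.card ≤ T.verts.card := by
  induction h with
  | init => exact ⟨.init w, .inl rfl, by simp [layersInit]⟩
  | step n s s' _ hstep ih =>
    obtain ⟨hinv, hsep, hcard⟩ := ih
    obtain ⟨hinv', hsep', hcard'⟩ := hstep.invariant hw hl hinv hsep
    exact ⟨hinv', hsep', by omega⟩

lemma LayersInvariant.exists_step {w : V → ℝ} (hw : ∀ v ∈ T.verts, 0 ≤ w v) (hl : T.Light)
    {s : LayersState V} (h : T.LayersInvariant w s) (hs : T.SeparatedRoot s)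
    (hW : s.W.Nonempty) : ∃ s', T.LayersStep w s s' := by
  rcases (T.inNbhd (s.U s.i) ∩ s.W).eq_empty_or_nonempty with hN | hN
  · obtain ⟨z, hz, hmin⟩ := s.W.exists_min_image (fun v => (T.inNbhd {v} ∩ s.W).card) hW
    exact ⟨_, .fresh s z ∅ hN hz hmin
      ((hl.noTriangleIn_inNbhd h.W_subset hz hmin).cdzAnswer_empty hw)⟩
  · have hne : ∀ v ∈ T.inNbhd (s.U s.i) ∩ s.W, ∃ u ∈ s.U s.i, T.Adj v u := fun v hv =>
      (mem_inNbhd.1 (mem_inter.1 hv).1).2.2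
    obtain ⟨v, hv⟩ := id hN
    obtain ⟨u, hu, -⟩ := hne v hv
    obtain ⟨y, hy⟩ := hs.exists_separates hu
    obtain ⟨z, hz, z', hz', hdom⟩ := hl.exists_inDominates hy inter_subset_right hN hne
    -- Domination is symmetric in z and z', so they can be ordered by weight.
    rcases le_total (weight w (T.inNbhd {z'} ∩ s.W)) (weight w (T.inNbhd {z} ∩ s.W)) with
      hle | hle
    · exact ⟨_, .grow s z z' hW hN hz hz' hdom hle⟩
    · rw [pair_comm] at hdom
      exact ⟨_, .grow s z' z hW hN hz' hz hdom hle⟩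

/-- A run without output could be continued forever, but every call removes an unseen vertex. -/
lemma exists_layersOutput {w : V → ℝ} (hw : ∀ v ∈ T.verts, 0 ≤ w v) (hl : T.Light) :
    ∃ F', T.LayersOutput w F' := by
  by_contra! hcon
  have hreach : ∀ n, ∃ s, T.LayersReach w n s := by
    intro n
    induction n with
    | zero => exact ⟨_, .init⟩
    | succ n ih =>
      obtain ⟨s, hs⟩ := ih
      have hW : s.W.Nonempty :=
        nonempty_iff_ne_empty.2 fun h => hcon _ ⟨n, s, hs, h, rfl⟩
      obtain ⟨hinv, hsep, -⟩ := hs.invariant hw hl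
      obtain ⟨s', hs'⟩ := hinv.exists_step hw hl hsep hW
      exact ⟨s', .step n s s' hs hs'⟩
  obtain ⟨s, hs⟩ := hreach (T.verts.card + 1)
  have := (hs.invariant hw hl).2.2
  omega

end Layers
-- The output: feedback vertex set and weight bound.
section Output

variable {V : Type*} [DecidableEq V] {T : Tournament V} {w : V → ℝ} {s : LayersState V}

lemma mem_layers {p : ℕ} {v : V} :
    v ∈ s.layers p ↔ ∃ j ≤ s.i, j % 2 = p ∧ v ∈ s.U j ∪ s.S j := by
  simp only [LayersState.layers, mem_biUnion, mem_filter, mem_range, Nat.lt_succ_iff, and_assoc]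

lemma mem_localSolutions {p : ℕ} {v : V} :
    v ∈ s.localSolutions p ↔ ∃ j ≤ s.i, j % 2 = p ∧ v ∈ s.F j := by
  simp only [LayersState.localSolutions, mem_biUnion, mem_filter, mem_range, Nat.lt_succ_iff,
    and_assoc]

lemma LayersInvariant.layers_subset (h : T.LayersInvariant w s) (p : ℕ) :
    s.layers p ⊆ T.verts := by
  intro v hv
  obtain ⟨j, hj, -, hv⟩ := mem_layers.1 hv
  exact (mem_sdiff.1 (h.layer_subset j hj hv)).1

lemma LayersInvariant.localSolutions_subset (h : T.LayersInvariant w s) (p : ℕ) :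
    s.localSolutions p ⊆ s.layers p := by
  intro v hv
  obtain ⟨j, hj, hjp, hv⟩ := mem_localSolutions.1 hv
  exact mem_layers.2 ⟨j, hj, hjp, (h.good j hj).F_subset hv⟩

/-- The layers of one parity together with the local solutions of the other parity form a
feedback vertex set. -/
lemma LayersInvariant.isFVS (h : T.LayersInvariant w s) (hW : s.W = ∅) {p q : ℕ}
    (hpq : ∀ j, j % 2 = p ∨ j % 2 = q) : T.IsFVS (s.localSolutions p ∪ s.layers q) := by
  refine isFVS_iff.2 ⟨union_subset ((h.localSolutions_subset p).trans (h.layers_subset p))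
    (h.layers_subset q), fun a b c ha hb hc hab hbc hca => ?_⟩
  have key : ∀ v ∈ T.verts, v ∉ s.localSolutions p ∪ s.layers q →
      ∃ j ≤ s.i, j % 2 = p ∧ v ∈ s.U j := by
    intro v hv hvn
    rw [mem_union, not_or, mem_localSolutions, mem_layers] at hvn
    obtain ⟨j, hj, hvj⟩ := h.cover v hv (by simp [hW])
    have hjp : j % 2 = p := (hpq j).resolve_right fun hq => hvn.2 ⟨j, hj, hq, hvj⟩
    refine ⟨j, hj, hjp, (mem_union.1 hvj).resolve_right fun hS => ?_⟩
    exact hvn.1 ⟨j, hj, hjp, (h.good j hj).S_subset hS⟩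
  -- Backward arcs join only consecutive layers, which have different parity. Around a triangle the
  -- index therefore never drops and must be constant.
  have mono : ∀ {u v j k}, T.Adj u v → j ≤ s.i → j % 2 = p → k % 2 = p → u ∈ s.U j →
      v ∈ s.U k → j ≤ k := by
    intro u v j k huv hj hjp hkp hu hv
    by_contra hcon
    exact T.asymm huv (h.adj k j (by omega) hj v hv u hu)
  obtain ⟨i, hi, hip, hai⟩ := key a (T.adj_left hab) ha
  obtain ⟨j, hj, hjp, hbj⟩ := key b (T.adj_left hbc) hb
  obtain ⟨k, hk, hkp, hck⟩ := key c (T.adj_left hca) hc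
  have h1 := mono hab hi hip hjp hai hbj
  have h2 := mono hbc hj hjp hkp hbj hck
  have h3 := mono hca hk hkp hip hck hai
  obtain rfl : i = j := by omega
  obtain rfl : i = k := by omega
  exact (h.good i hi).noTriangle a hai b hbj c hck hab hbc hca

lemma LayersInvariant.disjoint_of_ne (h : T.LayersInvariant w s) {j k : ℕ} (hj : j ≤ s.i)
    (hk : k ≤ s.i) (hjk : j ≠ k) : Disjoint (s.U j ∪ s.S j) (s.U k ∪ s.S k) := by
  rcases hjk.lt_or_gt with hlt | hlt
  · exact h.disjoint j hj k hk hlt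
  · exact (h.disjoint k hk j hj hlt).symm

lemma LayersInvariant.weight_localSolutions_le (hw : ∀ v ∈ T.verts, 0 ≤ w v)
    (h : T.LayersInvariant w s) (p : ℕ) :
    2 * weight w (s.localSolutions p) ≤ weight w (s.layers p) := by
  have hle : ∀ j ∈ (range (s.i + 1)).filter (fun j => j % 2 = p), j ≤ s.i := fun j hj =>
    Nat.lt_succ_iff.1 (mem_range.1 (mem_filter.1 hj).1)
  have hsum : weight w (s.layers p) =
      ∑ j ∈ (range (s.i + 1)).filter (fun j => j % 2 = p), weight w (s.U j ∪ s.S j) :=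
    sum_biUnion fun j hj k hk hjk => h.disjoint_of_ne (hle j hj) (hle k hk) hjk
  rw [hsum]
  refine (mul_le_mul_of_nonneg_left (weight_biUnion_le fun j hj v hv => ?_)
    zero_le_two).trans ?_
  · exact hw v (mem_sdiff.1 (h.layer_subset j (hle j hj)
      ((h.good j (hle j hj)).F_subset hv))).1
  · rw [mul_sum]
    exact sum_le_sum fun j hj => (h.good j (hle j hj)).weight_le

lemma LayersInvariant.weight_layers_add_le (hw : ∀ v ∈ T.verts, 0 ≤ w v)
    (h : T.LayersInvariant w s) {p q : ℕ} (hpq : p ≠ q) :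
    weight w (s.layers p) + weight w (s.layers q) ≤ weight w T.verts := by
  have hd : Disjoint (s.layers p) (s.layers q) := by
    refine disjoint_left.2 fun v hp hq => ?_
    obtain ⟨j, hj, rfl, hvj⟩ := mem_layers.1 hp
    obtain ⟨k, hk, rfl, hvk⟩ := mem_layers.1 hq
    exact disjoint_left.1 (h.disjoint_of_ne hj hk fun hjk => hpq (by rw [hjk])) hvj hvk
  rw [← weight_union_of_disjoint hd]
  exact weight_mono hw (union_subset (h.layers_subset p) (h.layers_subset q))

/-- With P ≥ Q the weights of the two classes and P + Q ≤ w(V), the cost is at most P/2 + Q = (P +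
Q)/2 + Q/2 ≤ 3/4 · w(V). -/
lemma LayersInvariant.weight_solution_le (hw : ∀ v ∈ T.verts, 0 ≤ w v)
    (h : T.LayersInvariant w s) {p q : ℕ} (hpq : p ≠ q)
    (hle : weight w (s.layers q) ≤ weight w (s.layers p)) :
    weight w (s.localSolutions p ∪ s.layers q) ≤ 3 / 4 * weight w T.verts := by
  have h1 := h.weight_localSolutions_le hw p
  have h2 := h.weight_layers_add_le hw hpq
  have h3 : weight w (s.localSolutions p ∪ s.layers q) ≤ _ :=
    weight_union_le fun v hv => hw v (h.layers_subset q hv)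
  linarith

lemma LayersOutput.isFVS_and_weight_le (hw : ∀ v ∈ T.verts, 0 ≤ w v) (hl : T.Light)
    {F' : Finset V} (hF' : T.LayersOutput w F') :
    T.IsFVS F' ∧ weight w F' ≤ 3 / 4 * weight w T.verts := by
  obtain ⟨n, s, hs, hW, rfl⟩ := hF'
  have h := (hs.invariant hw hl).1
  rw [LayersState.result]
  split_ifs with hle
  · exact ⟨h.isFVS hW fun j => by omega, h.weight_solution_le hw zero_ne_one hle⟩
  · exact ⟨h.isFVS hW fun j => by omega,
      h.weight_solution_le hw one_ne_zero (not_le.1 hle).le⟩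

end Output

end Tournament

theorem mainTheorem3 {V : Type*} [DecidableEq V] (T : Tournament V) (w : V → ℝ)
    (hw : ∀ v ∈ T.verts, 0 ≤ w v) (F Z : Finset V) (hFZ : T.RoundingOutput w F Z)
    (T' : Tournament V) (hT' : T' = T.delete (F ∪ Z)) :
    -- the residual tournament is light, and each of its vertices lies in a triangle
    T'.Light ∧ (∀ v ∈ T'.verts, ∃ t ∈ T'.triangles, v ∈ t) ∧
    -- the layering algorithm never gets stuck and makes at most `|V(T')|` recursive calls
    (∀ n s, T'.LayersReach w n s →
      n ≤ T'.verts.card ∧ (s.W.Nonempty → ∃ s', T'.LayersStep w s s')) ∧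
    (∃ F', T'.LayersOutput w F') ∧
    -- every output has the claimed properties
    ∀ F', T'.LayersOutput w F' →
      T.IsFVS (F ∪ F') ∧
      weight w F' ≤ 3 / 4 * weight w T'.verts ∧
      3 / 4 * weight w T'.verts = 9 / 4 * T'.SA0 w ∧
      ∀ X, T'.IsFVS X → weight w F' ≤ 9 / 4 * weight w X := by
  subst hT'
  have hl := hFZ.invariant.light
  have hSA := hFZ.SA0_eq
  have hw' : ∀ v ∈ (T.delete (F ∪ Z)).verts, 0 ≤ w v := fun v hv => by
    rw [Tournament.delete_verts] at hv
    exact hw v (mem_sdiff.1 hv).1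
  refine ⟨hl, hFZ.exists_triangle, fun n s hs => ?_, Tournament.exists_layersOutput hw' hl,
    fun F' hF' => ?_⟩
  · obtain ⟨hinv, hsep, hcard⟩ := hs.invariant hw' hl
    exact ⟨by omega, hinv.exists_step hw' hl hsep⟩
  · obtain ⟨hfvs, hle⟩ := hF'.isFVS_and_weight_le hw' hl
    refine ⟨hFZ.invariant.isFVS_union hfvs, hle, by linarith, fun X hX => ?_⟩
    have := Tournament.SA0_le_weight hw' hX
    linarith
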